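/- Let $\alpha>0$ and let $(c_j)_{j\ge 0}$ be a nonnegative solution on $[0,\infty)$ of the system $$\dot c_0=\alpha-c_0c_1,\qquad \dot c_1=\alpha-c_1^2-c_0c_1,\qquad \dot c_j=c_1c_{j-1}-c_1c_j\quad(j\ge 2).$$ Put $\tau(t):=\int_0^t c_1(s)\,ds$ for $t\ge 0$. Then $\tau$ is a bijection of $[0,\infty)$ onto $[0,\infty)$; with $t(\tau)$ its inverse function and $\tilde c_j(\tau):=c_j(t(\tau))$, the following hold: (i) $\displaystyle\lim_{t\to+\infty}\frac23\left(\frac3\alpha\right)^{1/3}t^{-2/3}\,\tau(t)=1$; (ii) $\displaystyle\lim_{\tau\to+\infty}\sqrt{\frac{2\tau}{\alpha}}\;\tilde c_1(\tau)=1$. -/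

import Mathlib

open Set Filter Topology

/-- `c = (c_j)_{j ≥ 0}` is a nonnegative (classical, global) solution on `[0, ∞)` of the constant
coefficient addition model with constant monomer input rate `α`, in closed form, where `c 0` is the
total number of clusters and `c j`, for `j ≥ 1`, is the concentration of `j`-clusters:
`c_0' = α - c_0 c_1`, `c_1' = α - c_1^2 - c_0 c_1`, `c_j' = c_1 c_{j-1} - c_1 c_j` for `j ≥ 2`.
At `t = 0` the derivative is the right derivative. -/
structure IsNonnegSolution (α : ℝ) (c : ℕ → ℝ → ℝ) : Prop where
  nonneg : ∀ j : ℕ, ∀ t : ℝ, 0 ≤ t → 0 ≤ c j t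
  deriv_zero : ∀ t : ℝ, 0 ≤ t →
    HasDerivWithinAt (c 0) (α - c 0 t * c 1 t) (Ici 0) t
  deriv_one : ∀ t : ℝ, 0 ≤ t →
    HasDerivWithinAt (c 1) (α - c 1 t ^ 2 - c 0 t * c 1 t) (Ici 0) t
  deriv_of_two_le : ∀ j : ℕ, 2 ≤ j → ∀ t : ℝ, 0 ≤ t →
    HasDerivWithinAt (c j) (c 1 t * c (j - 1) t - c 1 t * c j t) (Ici 0) t

/-- The new time `τ(t) = ∫_0^t c_1(s) ds`. -/
noncomputable def newTime (c : ℕ → ℝ → ℝ) (t : ℝ) : ℝ :=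
  ∫ s in (0 : ℝ)..t, c 1 s

/-- The inverse function `t(τ)` of `τ(t)`, with values in `[0, ∞)`. -/
noncomputable def oldTime (c : ℕ → ℝ → ℝ) (τ : ℝ) : ℝ :=
  Function.invFunOn (newTime c) (Ici 0) τ

/-- The rescaled variables `c̃_j(τ) = c_j(t(τ))`. -/
noncomputable def cTilde (c : ℕ → ℝ → ℝ) (j : ℕ) (τ : ℝ) : ℝ :=
  c j (oldTime c τ)

/-! Put `w = c 0 - c 1`; then `w' = c 1 ^ 2`. Comparison arguments give `w → ∞`, `c 1 → 0` and `c 0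
* c 1 → α`, hence `w * c 1 → α`. Since `(w ^ 2)' = 2 * (w * c 1) * τ'` and `(w ^ 3)' = 3 * (w * c 1)
^ 2`, l'Hôpital gives `w ^ 2 / τ → 2 * α` and `w ^ 3 / t → 3 * α ^ 2`. Eliminating `w` yields `τ * c
1 ^ 2 → α / 2` (`tendsto_newTime_mul_sq`) and `τ ^ 3 / t ^ 2 → 9 * α / 8`
(`tendsto_newTime_cube_div_sq`); roots of these are (ii) and (i). -/

section RealAsymptotics

variable {f g f' g' : ℝ → ℝ}

/-- A function which decreases at a definite rate as long as it is at least `b` is eventually at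
most `b`. -/
theorem eventually_le_of_deriv_le_neg {b δ : ℝ} (hδ : 0 < δ)
    (hf : ∀ᶠ t in atTop, HasDerivAt f (f' t) t)
    (h : ∀ᶠ t in atTop, b ≤ f t → f' t ≤ -δ) : ∀ᶠ t in atTop, f t ≤ b := by
  obtain ⟨T, hT⟩ := eventually_atTop.1 (hf.and h)
  have hex : ∃ t₀, T ≤ t₀ ∧ f t₀ ≤ b := by
    by_contra! hcon
    have hanti : AntitoneOn (fun t => f t + δ * t) (Ici T) := by
      have hd : ∀ t ∈ Ici T, HasDerivAt (fun t => f t + δ * t) (f' t + δ * 1) t := fun t ht =>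
        (hT t ht).1.add ((hasDerivAt_id t).const_mul δ)
      refine antitoneOn_of_hasDerivWithinAt_nonpos (convex_Ici T)
        (fun t ht => (hd t ht).continuousAt.continuousWithinAt)
        (fun t ht => (hd t (interior_subset ht)).hasDerivWithinAt) fun t ht => ?_
      have := (hT t (interior_subset ht)).2 (hcon t (interior_subset ht)).le
      linarith
    have hb := hcon T le_rfl
    have hnn : 0 ≤ (f T - b) / δ := div_nonneg (by linarith) hδ.le
    have h1 := hanti (mem_Ici.2 le_rfl) (mem_Ici.2 (by linarith : T ≤ T + (f T - b) / δ))
      (by linarith)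
    have h2 := hcon (T + (f T - b) / δ) (by linarith)
    have h3 : δ * (T + (f T - b) / δ) = δ * T + (f T - b) := by field_simp
    simp only at h1
    linarith
  obtain ⟨t₀, ht₀, hft₀⟩ := hex
  filter_upwards [eventually_ge_atTop t₀] with t ht
  -- The level `b` is a barrier: wherever `f = b` the derivative is negative.
  refine image_le_of_deriv_right_lt_deriv_boundary' (f := f) (f' := f') (a := t₀) (b := t)
    (B := fun _ => b) (B' := fun _ => 0)
    (fun s hs => (hT s (ht₀.trans hs.1)).1.continuousAt.continuousWithinAt)
    (fun s hs => (hT s (ht₀.trans hs.1)).1.hasDerivWithinAt) hft₀ continuousOn_const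
    (fun s _ => hasDerivWithinAt_const _ _ _) (fun s hs hfs => ?_) (right_mem_Icc.2 ht)
  have := (hT s (ht₀.trans hs.1)).2 hfs.ge
  linarith

/-- A function which increases at a definite rate as long as it is at most `b` is eventually at
least `b`. -/
theorem eventually_ge_of_le_deriv {b δ : ℝ} (hδ : 0 < δ)
    (hf : ∀ᶠ t in atTop, HasDerivAt f (f' t) t)
    (h : ∀ᶠ t in atTop, f t ≤ b → δ ≤ f' t) : ∀ᶠ t in atTop, b ≤ f t := by
  have := eventually_le_of_deriv_le_neg (f := fun t => -f t) (f' := fun t => -f' t) (b := -b) hδ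
    (hf.mono fun t ht => ht.neg)
    (h.mono fun t ht hb => neg_le_neg (ht (by linarith)))
  exact this.mono fun t ht => by linarith

theorem exists_le_mul_add_of_deriv_le {b : ℝ}
    (hf : ∀ᶠ t in atTop, HasDerivAt f (f' t) t) (hg : ∀ᶠ t in atTop, HasDerivAt g (g' t) t)
    (h : ∀ᶠ t in atTop, f' t ≤ b * g' t) : ∃ C, ∀ᶠ t in atTop, f t ≤ b * g t + C := by
  obtain ⟨T, hT⟩ := eventually_atTop.1 (hf.and (hg.and h))
  have hd : ∀ t ∈ Ici T, HasDerivAt (fun t => f t - b * g t) (f' t - b * g' t) t := fun t ht =>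
    (hT t ht).1.sub ((hT t ht).2.1.const_mul b)
  have hanti : AntitoneOn (fun t => f t - b * g t) (Ici T) :=
    antitoneOn_of_hasDerivWithinAt_nonpos (convex_Ici T)
      (fun t ht => (hd t ht).continuousAt.continuousWithinAt)
      (fun t ht => (hd t (interior_subset ht)).hasDerivWithinAt)
      fun t ht => sub_nonpos.2 (hT t (interior_subset ht)).2.2
  refine ⟨f T - b * g T, ?_⟩
  filter_upwards [eventually_ge_atTop T] with t ht
  have : f t - b * g t ≤ f T - b * g T := hanti (mem_Ici.2 le_rfl) ht ht
  linarith

theorem eventually_div_lt_of_deriv {L a : ℝ}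
    (hf : ∀ᶠ t in atTop, HasDerivAt f (f' t) t) (hg : ∀ᶠ t in atTop, HasDerivAt g (g' t) t)
    (hg' : ∀ᶠ t in atTop, 0 < g' t) (hgtop : Tendsto g atTop atTop)
    (hL : Tendsto (fun t => f' t / g' t) atTop (𝓝 L)) (ha : L < a) :
    ∀ᶠ t in atTop, f t / g t < a := by
  -- The gap between `b` and `a` absorbs the vanishing error `C / g t`.
  obtain ⟨b, hLb, hba⟩ := exists_between ha
  obtain ⟨C, hC⟩ := exists_le_mul_add_of_deriv_le (b := b) hf hg <| by
    filter_upwards [hg', hL.eventually_lt_const hLb] with t h1 h2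
    exact ((div_lt_iff₀ h1).1 h2).le
  have hz : Tendsto (fun t => b + C / g t) atTop (𝓝 (b + 0)) :=
    tendsto_const_nhds.add (hgtop.const_div_atTop C)
  filter_upwards [hC, hgtop.eventually_gt_atTop 0, hz.eventually_lt_const (by simpa using hba)]
    with t h1 h2 h3
  refine lt_of_le_of_lt ?_ h3
  rw [div_le_iff₀ h2, add_mul, div_mul_cancel₀ _ h2.ne']
  exact h1

/-- L'Hôpital's rule at infinity, for a denominator tending to infinity. -/
theorem tendsto_div_of_tendsto_deriv_div {L : ℝ}
    (hf : ∀ᶠ t in atTop, HasDerivAt f (f' t) t) (hg : ∀ᶠ t in atTop, HasDerivAt g (g' t) t)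
    (hg' : ∀ᶠ t in atTop, 0 < g' t) (hgtop : Tendsto g atTop atTop)
    (hL : Tendsto (fun t => f' t / g' t) atTop (𝓝 L)) :
    Tendsto (fun t => f t / g t) atTop (𝓝 L) := by
  refine tendsto_order.2 ⟨fun a ha => ?_, fun a ha =>
    eventually_div_lt_of_deriv hf hg hg' hgtop hL ha⟩
  have := eventually_div_lt_of_deriv (f := fun t => -f t) (f' := fun t => -f' t) (L := -L)
    (a := -a) (hf.mono fun t ht => ht.neg) hg hg' hgtop
    (by simpa only [neg_div] using hL.neg) (neg_lt_neg ha)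
  filter_upwards [this] with t ht
  rw [neg_div] at ht
  linarith

end RealAsymptotics

/-! ### Long-time behaviour of the monomers and of the total cluster number -/

namespace IsNonnegSolution

variable {α : ℝ} {c : ℕ → ℝ → ℝ}

theorem hasDerivAt_zero (hc : IsNonnegSolution α c) {t : ℝ} (ht : 0 < t) :
    HasDerivAt (c 0) (α - c 0 t * c 1 t) t :=
  (hc.deriv_zero t ht.le).hasDerivAt (Ici_mem_nhds ht)

theorem hasDerivAt_one (hc : IsNonnegSolution α c) {t : ℝ} (ht : 0 < t) :
    HasDerivAt (c 1) (α - c 1 t ^ 2 - c 0 t * c 1 t) t :=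
  (hc.deriv_one t ht.le).hasDerivAt (Ici_mem_nhds ht)

theorem hasDerivAt_sub (hc : IsNonnegSolution α c) {t : ℝ} (ht : 0 < t) :
    HasDerivAt (fun t => c 0 t - c 1 t) (c 1 t ^ 2) t :=
  ((hc.hasDerivAt_zero ht).sub (hc.hasDerivAt_one ht)).congr_deriv (by ring)

theorem hasDerivAt_mul (hc : IsNonnegSolution α c) {t : ℝ} (ht : 0 < t) :
    HasDerivAt (fun t => c 0 t * c 1 t)
      ((α - c 0 t * c 1 t) * (c 0 t + c 1 t) - c 0 t * c 1 t * c 1 t) t :=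
  ((hc.hasDerivAt_zero ht).mul (hc.hasDerivAt_one ht)).congr_deriv (by ring)

/-- A zero at positive time would be a local minimum, but the derivative there is `α`. -/
theorem monomer_pos (hα : 0 < α) (hc : IsNonnegSolution α c) {t : ℝ} (ht : 0 < t) : 0 < c 1 t := by
  refine (hc.nonneg 1 t ht.le).lt_of_ne' fun h0 => ?_
  have hmin : IsLocalMin (c 1) t := by
    filter_upwards [Ici_mem_nhds ht] with s hs
    rw [h0]
    exact hc.nonneg 1 s hs
  have := hmin.hasDerivAt_eq_zero (hc.hasDerivAt_one ht)
  rw [h0] at this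
  norm_num at this
  exact hα.ne' this

/-- If the nondecreasing difference stayed below `M`, then `c 0` would be controlled by `c 1`, which
keeps `c 1` away from zero; the difference would then grow at least linearly. -/
theorem eventually_sub_ge (hα : 0 < α) (hc : IsNonnegSolution α c) {M : ℝ} (hM : 0 ≤ M) :
    ∀ᶠ t in atTop, M ≤ c 0 t - c 1 t := by
  have hmono : MonotoneOn (fun t => c 0 t - c 1 t) (Ioi 0) :=
    monotoneOn_of_hasDerivWithinAt_nonneg (convex_Ioi 0)
      (fun t ht => (hc.hasDerivAt_sub ht).continuousAt.continuousWithinAt)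
      (fun t ht => (hc.hasDerivAt_sub (interior_subset ht)).hasDerivWithinAt)
      fun t _ => sq_nonneg _
  by_contra hcon
  have hlt : ∀ t, 0 < t → c 0 t - c 1 t < M := by
    intro t ht
    by_contra! hle
    refine hcon ?_
    filter_upwards [eventually_ge_atTop t] with s hs
    exact hle.trans (hmono ht (ht.trans_le hs) hs)
  have hpos := eventually_gt_atTop (0 : ℝ)
  -- For `c 1 ≤ b ≤ 1` and `c 0 < M + c 1`, the loss `c 1 ^ 2 + c 0 * c 1` is at most `b * (2 + M) ≤
  -- α / 2`.
  obtain ⟨b, hb, hb1, hb2⟩ : ∃ b : ℝ, 0 < b ∧ b ≤ 1 ∧ b * (2 + M) ≤ α / 2 := by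
    refine ⟨min 1 (α / 2 / (2 + M)), lt_min zero_lt_one (by positivity), min_le_left _ _, ?_⟩
    exact (le_div_iff₀ (by positivity)).1 (min_le_right _ _)
  have hy : ∀ᶠ t in atTop, b ≤ c 1 t := by
    refine eventually_ge_of_le_deriv (half_pos hα) (hpos.mono fun t ht => hc.hasDerivAt_one ht) ?_
    filter_upwards [hpos] with t ht hyb
    have h0 := hc.nonneg 1 t ht.le
    have h1 := hlt t ht
    nlinarith [mul_nonneg h0 (sub_nonneg.2 h1.le), mul_nonneg h0 (sub_nonneg.2 (hyb.trans hb1)),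
      mul_nonneg (sub_nonneg.2 hyb) (by linarith : 0 ≤ 2 + M)]
  refine hcon (eventually_ge_of_le_deriv (sq_pos_of_pos hb)
    (hpos.mono fun t ht => hc.hasDerivAt_sub ht) ?_)
  filter_upwards [hy] with t ht _
  gcongr

theorem tendsto_sub_atTop (hα : 0 < α) (hc : IsNonnegSolution α c) :
    Tendsto (fun t => c 0 t - c 1 t) atTop atTop :=
  tendsto_atTop.2 fun M => (hc.eventually_sub_ge hα (le_max_right M 0)).mono fun _ ht =>
    (le_max_left M 0).trans ht

theorem tendsto_zero_atTop (hα : 0 < α) (hc : IsNonnegSolution α c) :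
    Tendsto (c 0) atTop atTop := by
  refine tendsto_atTop_mono' _ ?_ (hc.tendsto_sub_atTop hα)
  filter_upwards [eventually_ge_atTop 0] with t ht
  linarith [hc.nonneg 1 t ht]

theorem tendsto_one (hα : 0 < α) (hc : IsNonnegSolution α c) : Tendsto (c 1) atTop (𝓝 0) := by
  have hpos := eventually_gt_atTop (0 : ℝ)
  refine tendsto_order.2 ⟨fun a ha => hpos.mono fun t ht => ha.trans (hc.monomer_pos hα ht),
    fun a ha => ?_⟩
  obtain ⟨b, hb, hba⟩ := exists_between ha
  refine (eventually_le_of_deriv_le_neg hα (hpos.mono fun t ht => hc.hasDerivAt_one ht)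
    ?_).mono fun t ht => lt_of_le_of_lt ht hba
  filter_upwards [(hc.tendsto_zero_atTop hα).eventually_ge_atTop (2 * α / b)] with t hx hy
  have h1 : 2 * α ≤ c 0 t * c 1 t := by
    calc 2 * α = 2 * α / b * b := by field_simp
      _ ≤ c 0 t * c 1 t := by gcongr; exact le_trans (by positivity) hx
  nlinarith [sq_nonneg (c 1 t)]

/-- The product `p` obeys `p' = (α - p) * (c 0 + c 1) - p * c 1`: relaxation to `α` at a rate
tending to infinity, with a small perturbation. -/
theorem tendsto_mul (hα : 0 < α) (hc : IsNonnegSolution α c) :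
    Tendsto (fun t => c 0 t * c 1 t) atTop (𝓝 α) := by
  have hpos := eventually_gt_atTop (0 : ℝ)
  have hx := hc.tendsto_zero_atTop hα
  have hd := hpos.mono fun t ht => hc.hasDerivAt_mul ht
  refine tendsto_order.2 ⟨fun a ha => ?_, fun a ha => ?_⟩
  · obtain ⟨b, hab, hb⟩ := exists_between ha
    refine (eventually_ge_of_le_deriv zero_lt_one hd ?_).mono fun t ht => lt_of_lt_of_le hab ht
    -- The threshold makes the relaxation term at least `|b| + 1`, of which the perturbation costs
    -- at most `|b|`.
    filter_upwards [hpos, hx.eventually_ge_atTop ((|b| + 1) / (α - b)),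
      (hc.tendsto_one hα).eventually_lt_const zero_lt_one] with t ht h1 h2 hp
    have hx0 := hc.nonneg 0 t ht.le
    have hy0 := hc.nonneg 1 t ht.le
    have h3 := (div_le_iff₀ (sub_pos.2 hb)).1 h1
    have h4 : c 0 t * c 1 t * c 1 t ≤ |b| * 1 := by
      gcongr
      exact hp.trans (le_abs_self b)
    have h5 : c 0 t * (α - b) ≤ (α - c 0 t * c 1 t) * (c 0 t + c 1 t) := by
      rw [mul_comm]
      gcongr
      · linarith
      · linarith
    linarith
  · obtain ⟨b, hb, hba⟩ := exists_between ha
    refine (eventually_le_of_deriv_le_neg (sub_pos.2 hb) hd ?_).mono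
      fun t ht => lt_of_le_of_lt ht hba
    filter_upwards [hpos, hx.eventually_ge_atTop 1] with t ht h1 hp
    have hy0 := hc.nonneg 1 t ht.le
    have h2 : 0 ≤ c 0 t * c 1 t * c 1 t := by positivity
    nlinarith [mul_nonneg (by linarith : 0 ≤ c 0 t * c 1 t - α)
      (by linarith : 0 ≤ c 0 t + c 1 t - 1)]

theorem tendsto_sub_mul (hα : 0 < α) (hc : IsNonnegSolution α c) :
    Tendsto (fun t => (c 0 t - c 1 t) * c 1 t) atTop (𝓝 α) := by
  simpa [sub_mul] using (hc.tendsto_mul hα).sub ((hc.tendsto_one hα).mul (hc.tendsto_one hα))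

/-! ### The change of time -/

theorem continuousOn_one (hc : IsNonnegSolution α c) : ContinuousOn (c 1) (Ici 0) :=
  fun t ht => (hc.deriv_one t ht).continuousWithinAt

theorem hasDerivAt_newTime (hc : IsNonnegSolution α c) {t : ℝ} (ht : 0 < t) :
    HasDerivAt (newTime c) (c 1 t) t := by
  refine intervalIntegral.integral_hasDerivAt_right ?_ ?_ (hc.hasDerivAt_one ht).continuousAt
  · exact (hc.continuousOn_one.mono (by rw [uIcc_of_le ht.le]; exact Icc_subset_Ici_self)
      ).intervalIntegrable
  · exact (hc.continuousOn_one.mono Ioi_subset_Ici_self).stronglyMeasurableAtFilter isOpen_Ioi t ht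

theorem continuousOn_newTime (hc : IsNonnegSolution α c) :
    ContinuousOn (newTime c) (Ici 0) := by
  intro t ht
  rcases (mem_Ici.1 ht).eq_or_lt with rfl | ht
  · have h : ContinuousOn (newTime c) (Icc 0 1) := by
      have := intervalIntegral.continuousOn_primitive_interval (μ := MeasureTheory.volume)
        (f := c 1) (a := 0) (b := 1)
        ((hc.continuousOn_one.mono (by simp [Icc_subset_Ici_self])).integrableOn_compact
          isCompact_uIcc)
      rwa [uIcc_of_le zero_le_one] at this
    exact (h 0 (by simp)).mono_of_mem_nhdsWithin (Icc_mem_nhdsGE zero_lt_one)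
  · exact (hc.hasDerivAt_newTime ht).continuousAt.continuousWithinAt

theorem strictMonoOn_newTime (hα : 0 < α) (hc : IsNonnegSolution α c) :
    StrictMonoOn (newTime c) (Ici 0) := by
  refine strictMonoOn_of_hasDerivWithinAt_pos (f' := c 1) (convex_Ici 0) hc.continuousOn_newTime
    (fun t ht => ?_) fun t ht => ?_
  all_goals rw [interior_Ici, mem_Ioi] at ht
  · exact (hc.hasDerivAt_newTime ht).hasDerivWithinAt
  · exact hc.monomer_pos hα ht

/-- Once `c 1 < 1`, `w' = c 1 ^ 2 ≤ c 1 = τ'`, so `τ` dominates `w` up to a constant. -/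
theorem tendsto_newTime (hα : 0 < α) (hc : IsNonnegSolution α c) :
    Tendsto (newTime c) atTop atTop := by
  have hpos := eventually_gt_atTop (0 : ℝ)
  obtain ⟨C, hC⟩ := exists_le_mul_add_of_deriv_le (b := 1)
    (hpos.mono fun t ht => hc.hasDerivAt_sub ht)
    (hpos.mono fun t ht => hc.hasDerivAt_newTime ht) <| by
      filter_upwards [hpos, (hc.tendsto_one hα).eventually_lt_const zero_lt_one] with t ht h1
      nlinarith [hc.nonneg 1 t ht.le]
  refine tendsto_atTop_mono' _ ?_ (tendsto_atTop_add_const_right _ (-C) (hc.tendsto_sub_atTop hα))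
  filter_upwards [hC] with t ht
  linarith

theorem bijOn_newTime (hα : 0 < α) (hc : IsNonnegSolution α c) :
    BijOn (newTime c) (Ici 0) (Ici 0) := by
  have h0 : newTime c 0 = 0 := by simp [newTime]
  refine ⟨fun t ht => ?_, (hc.strictMonoOn_newTime hα).injOn, fun s hs => ?_⟩
  · rw [mem_Ici, ← h0]
    exact (hc.strictMonoOn_newTime hα).monotoneOn self_mem_Ici ht ht
  · obtain ⟨T, hT0, hT⟩ := ((eventually_ge_atTop 0).and
      ((hc.tendsto_newTime hα).eventually_ge_atTop s)).exists
    obtain ⟨t, ht, rfl⟩ := intermediate_value_Icc hT0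
      (hc.continuousOn_newTime.mono Icc_subset_Ici_self) ⟨h0.le.trans hs, hT⟩
    exact ⟨t, ht.1, rfl⟩

theorem newTime_oldTime (hα : 0 < α) (hc : IsNonnegSolution α c) {s : ℝ} (hs : 0 ≤ s) :
    newTime c (oldTime c s) = s :=
  (hc.bijOn_newTime hα).surjOn.rightInvOn_invFunOn (mem_Ici.2 hs)

theorem tendsto_oldTime (hα : 0 < α) (hc : IsNonnegSolution α c) :
    Tendsto (oldTime c) atTop atTop := by
  refine tendsto_atTop.2 fun M => ?_
  filter_upwards [eventually_ge_atTop (newTime c (max M 0)), eventually_ge_atTop 0] with s hs hs0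
  have hmem := (hc.bijOn_newTime hα).surjOn.mapsTo_invFunOn (mem_Ici.2 hs0)
  exact (le_max_left M 0).trans
    (((hc.strictMonoOn_newTime hα).le_iff_le (mem_Ici.2 (le_max_right M 0)) hmem).1
      (hs.trans_eq (hc.newTime_oldTime hα hs0).symm))

/-! ### Power laws and the final limits -/

theorem tendsto_sub_sq_div_newTime (hα : 0 < α) (hc : IsNonnegSolution α c) :
    Tendsto (fun t => (c 0 t - c 1 t) ^ 2 / newTime c t) atTop (𝓝 (2 * α)) := by
  have hpos := eventually_gt_atTop (0 : ℝ)
  refine tendsto_div_of_tendsto_deriv_div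
    (hpos.mono fun t ht => (hc.hasDerivAt_sub ht).pow 2)
    (hpos.mono fun t ht => hc.hasDerivAt_newTime ht)
    (hpos.mono fun t ht => hc.monomer_pos hα ht) (hc.tendsto_newTime hα) ?_
  refine ((hc.tendsto_sub_mul hα).const_mul 2).congr' ?_
  filter_upwards [hpos] with t ht
  have := (hc.monomer_pos hα ht).ne'
  field_simp
  norm_num

theorem tendsto_sub_cube_div (hα : 0 < α) (hc : IsNonnegSolution α c) :
    Tendsto (fun t => (c 0 t - c 1 t) ^ 3 / t) atTop (𝓝 (3 * α ^ 2)) := by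
  have hpos := eventually_gt_atTop (0 : ℝ)
  refine tendsto_div_of_tendsto_deriv_div
    (hpos.mono fun t ht => (hc.hasDerivAt_sub ht).pow 3)
    (Eventually.of_forall fun t => hasDerivAt_id t)
    (Eventually.of_forall fun _ => zero_lt_one) tendsto_id ?_
  refine (((hc.tendsto_sub_mul hα).pow 2).const_mul 3).congr fun t => ?_
  push_cast
  ring

theorem tendsto_newTime_mul_sq (hα : 0 < α) (hc : IsNonnegSolution α c) :
    Tendsto (fun t => newTime c t * c 1 t ^ 2) atTop (𝓝 (α / 2)) := by
  have h := ((hc.tendsto_sub_mul hα).pow 2).div (hc.tendsto_sub_sq_div_newTime hα) (by positivity)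
  rw [show α ^ 2 / (2 * α) = α / 2 by field_simp] at h
  refine h.congr' ?_
  filter_upwards [(hc.tendsto_sub_atTop hα).eventually_gt_atTop 0,
    (hc.tendsto_newTime hα).eventually_gt_atTop 0] with t h1 h2
  have := h1.ne'
  simp only [Pi.div_apply]
  field_simp

theorem tendsto_newTime_cube_div_sq (hα : 0 < α) (hc : IsNonnegSolution α c) :
    Tendsto (fun t => newTime c t ^ 3 / t ^ 2) atTop (𝓝 (9 * α / 8)) := by
  have h := ((hc.tendsto_sub_cube_div hα).pow 2).div
    ((hc.tendsto_sub_sq_div_newTime hα).pow 3) (by positivity)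
  rw [show (3 * α ^ 2) ^ 2 / (2 * α) ^ 3 = 9 * α / 8 by field_simp; norm_num] at h
  refine h.congr' ?_
  filter_upwards [(hc.tendsto_sub_atTop hα).eventually_gt_atTop 0,
    (hc.tendsto_newTime hα).eventually_gt_atTop 0, eventually_gt_atTop 0] with t h1 h2 h3
  have := h1.ne'
  simp only [Pi.div_apply]
  field_simp

end IsNonnegSolution

theorem proposition3 (α : ℝ) (hα : 0 < α) (c : ℕ → ℝ → ℝ) (hc : IsNonnegSolution α c) :
    Set.BijOn (newTime c) (Set.Ici 0) (Set.Ici 0) ∧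
    Tendsto (fun t : ℝ => (2 / 3 : ℝ) * (3 / α) ^ (1 / 3 : ℝ) * t ^ (-(2 / 3) : ℝ) * newTime c t)
      atTop (𝓝 1) ∧
    Tendsto (fun τ : ℝ => Real.sqrt (2 * τ / α) * cTilde c 1 τ) atTop (𝓝 1) := by
  refine ⟨hc.bijOn_newTime hα, ?_, ?_⟩
  · have h := ((hc.tendsto_newTime_cube_div_sq hα).const_mul (8 / (9 * α))).rpow_const
      (p := (1 / 3 : ℝ)) (Or.inr (by norm_num))
    rw [show 8 / (9 * α) * (9 * α / 8) = 1 by field_simp, Real.one_rpow] at h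
    refine h.congr' ?_
    filter_upwards [(hc.tendsto_newTime hα).eventually_gt_atTop 0, eventually_gt_atTop 0]
      with t h1 h2
    have hcube : ∀ {u : ℝ}, 0 ≤ u → (u ^ 3) ^ (1 / 3 : ℝ) = u := fun {u} hu => by
      rw [← Real.rpow_natCast, ← Real.rpow_mul hu]
      norm_num
    have ht : (t ^ (-(2 / 3) : ℝ)) ^ 3 = (t ^ 2)⁻¹ := by
      rw [← Real.rpow_natCast, ← Real.rpow_mul h2.le, ← Real.rpow_natCast, ← Real.rpow_neg h2.le]
      norm_num
    have ha : ((3 / α) ^ (1 / 3 : ℝ)) ^ 3 = 3 / α := by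
      rw [← Real.rpow_natCast, ← Real.rpow_mul (by positivity)]
      norm_num
    -- The expression is nonnegative, so it is the cube root of its cube, which is `8 / (9 * α) * (τ
    -- ^ 3 / t ^ 2)`.
    rw [← hcube (u := 2 / 3 * (3 / α) ^ (1 / 3 : ℝ) * t ^ (-(2 / 3) : ℝ) * newTime c t)
      (by positivity)]
    congr 1
    rw [mul_pow, mul_pow, mul_pow, ha, ht]
    field_simp
    norm_num
  · have h := (((hc.tendsto_newTime_mul_sq hα).const_mul (2 / α)).comp
      (hc.tendsto_oldTime hα)).sqrt
    rw [show 2 / α * (α / 2) = 1 by field_simp, Real.sqrt_one] at h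
    refine h.congr' ?_
    filter_upwards [eventually_ge_atTop 0, (hc.tendsto_oldTime hα).eventually_ge_atTop 0]
      with s hs hs'
    simp only [Function.comp_apply, hc.newTime_oldTime hα hs, cTilde]
    rw [← mul_assoc, Real.sqrt_mul (by positivity), Real.sqrt_sq (hc.nonneg 1 _ hs')]
    congr 2
    ring
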